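/- Let $\mathbb{K}$ be an algebraically closed field of characteristic $0$, and let $p\in\mathbb{K}[x,y]\setminus(\mathbb{K}[x]\cup\mathbb{K}[y])$ be irreducible. Let $\mathbb{K}[x,y]_p$ be the ring of rational functions in $\mathbb{K}(x,y)$ whose reduced denominator is not divisible by $p$. Let $r\in\mathbb{K}[x,y]_p$, and let $f\in\mathbb{K}(x)$, $g\in\mathbb{K}(y)$ be such that $r+qp=f-g$ for some $q\in\mathbb{K}[x,y]_p$. Let $C\subseteq\mathbb{P}^1(\mathbb{K})\times\mathbb{P}^1(\mathbb{K})$ be the curve defined by the bi-homogenization $x_0^{\deg_x p}y_0^{\deg_y p}\,p(x_1/x_0,y_1/y_0)$, where $\mathbb{P}^1(\mathbb{K})=\mathbb{K}\cup\{\infty\}$. The point $(\infty,\infty)$, when it lies on $C$, is called a pole of $r$ if there is a Puiseux series $\varphi\in\mathbb{K}\{\{x^{-1}\}\}$ with $p(x,\varphi)=0$, $\deg\varphi>0$ and $\deg r(x,\varphi)>0$. A general point $(s_1,s_2)$ is called a pole of $r$ if there is a pair $T=(T_1,T_2)$ of fractional linear transformations of $\mathbb{P}^1(\mathbb{K})$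 which maps $(s_1,s_2)$ to $(\infty,\infty)$ and is such that $(\infty,\infty)$ is a pole, in the previous sense, of $r\circ T^{-1}$ on the curve of the numerator of $p\circ T^{-1}$. The orbit of a point of $C$ is its class under the smallest equivalence relation on $C$ with $(a,b)\sim(c,d)$ whenever $a=c$ or $b=d$. The graph of an orbit has the elements of the orbit as its vertices, and two distinct vertices are adjacent if they share a common coordinate. A path is a sequence of vertices any two consecutive members of which are adjacent; it contains no cycle if no vertex occurs in it twice. Let $(s_1,s_2)\in C$ be a pole of $r$, and let $v_0,v_1,v_2,\dots$ be an infinite path in the graph of its orbit that starts at $v_0=(s_1,s_2)$, contains no cycle, and does not contain a pole of $r$ other than $(s_1,s_2)$. Then: 1. $s_1$ is not a pole of $f$, or $s_2$ is not a pole of $g$. 2. If the first coordinate of $v_1$ equals $s_1$, then $s_1$ is not a pole of $f$. 3. If the second coordinate of $v_1$ equals $s_2$, then $s_2$ is not a pole of $g$. -/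

import Mathlib

open scoped OnePoint

noncomputable section

namespace SepVar

/-- The polynomial ring `K[x,y]`; the variable `x` has index `0`, the variable `y` index `1`. -/
abbrev Poly2 (K : Type*) [Field K] : Type _ := MvPolynomial (Fin 2) K

/-- The field `K(x,y)` of rational functions in two variables. -/
abbrev Rat2 (K : Type*) [Field K] : Type _ := FractionRing (Poly2 K)

/-- The ambient field of generalized power series in a variable `u` with rational exponents.
The Puiseux series in `u = x⁻¹` are its elements that satisfy `IsPuiseux`. -/
abbrev Series (K : Type*) [Field K] : Type _ := HahnSeries ℚ K

section

variable {K : Type*} [Field K]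

/-- Numerator of a rational function in reduced form. -/
def num (r : Rat2 K) : Poly2 K := IsFractionRing.num (Poly2 K) r

/-- Denominator of a rational function in reduced form. -/
def den (r : Rat2 K) : Poly2 K := (IsFractionRing.den (Poly2 K) r : Poly2 K)

/-- The rational function `x`. -/
def X : Rat2 K := algebraMap (Poly2 K) (Rat2 K) (MvPolynomial.X 0)

/-- The rational function `y`. -/
def Y : Rat2 K := algebraMap (Poly2 K) (Rat2 K) (MvPolynomial.X 1)

/-- The substitution `r(a, b)` of elements `a`, `b` of an extension field of `K` into a rational
function `r ∈ K(x,y)`. It is meaningful when the denominator of `r` does not vanish at `(a, b)`. -/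
def subst {L : Type*} [Field L] [Algebra K L] (r : Rat2 K) (a b : L) : L :=
  MvPolynomial.aeval ![a, b] (num r) / MvPolynomial.aeval ![a, b] (den r)

/-- The rational function `f(x)` in `K(x,y)`, for `f` univariate. -/
def inX (f : RatFunc K) : Rat2 K := f.eval (algebraMap K (Rat2 K)) X

/-- The rational function `g(y)` in `K(x,y)`, for `g` univariate. -/
def inY (g : RatFunc K) : Rat2 K := g.eval (algebraMap K (Rat2 K)) Y

/-- The local ring `K[x,y]_p`: the rational functions whose reduced denominator is not divisible
by `p`. -/
def localRing (p : Poly2 K) : Set (Rat2 K) := {r | ¬ p ∣ den r}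

/-- The set `F(r,p)` of pairs `(f, g)` with `f(x) - g(y) = r + q p` for some `q ∈ K[x,y]_p`. -/
def F (r : Rat2 K) (p : Poly2 K) : Set (RatFunc K × RatFunc K) :=
  {fg | ∃ q ∈ localRing p, inX fg.1 - inY fg.2 = r + q * algebraMap (Poly2 K) (Rat2 K) p}

/-- The point `s` of the projective line `K ∪ {∞}` is a pole of the univariate rational
function `f`. -/
def IsPoleOf (f : RatFunc K) : OnePoint K → Prop
  | ∞ => f.denom.natDegree < f.num.natDegree
  | (s : K) => f.denom.IsRoot s

/-! ### The curve in `ℙ¹ × ℙ¹` and its orbits -/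

/-- Homogeneous coordinates `(x₀ : x₁)` of a point `x₁ / x₀` of the projective line. -/
def coords : OnePoint K → Fin 2 → K
  | ∞ => ![0, 1]
  | (s : K) => ![1, s]

/-- The value of the bi-homogenization `x₀ ^ deg_x p * y₀ ^ deg_y p * p (x₁ / x₀, y₁ / y₀)`. -/
def biHom (p : Poly2 K) (x y : Fin 2 → K) : K :=
  ∑ m ∈ p.support, p.coeff m *
    (x 0 ^ (p.degreeOf 0 - m 0) * x 1 ^ m 0) * (y 0 ^ (p.degreeOf 1 - m 1) * y 1 ^ m 1)

/-- The curve in `ℙ¹(K) × ℙ¹(K)` associated with the bi-homogenization of `p`. -/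
def curve (p : Poly2 K) : Set (OnePoint K × OnePoint K) :=
  {s | biHom p (coords s.1) (coords s.2) = 0}

/-- Two points of the curve share a common coordinate. -/
def ShareCoord {p : Poly2 K} (a b : curve p) : Prop :=
  a.1.1 = b.1.1 ∨ a.1.2 = b.1.2

/-- The orbit of a point: its class under the smallest equivalence relation on the curve that
relates any two points sharing a coordinate. -/
def orbit {p : Poly2 K} (s : curve p) : Set (curve p) :=
  {a | Relation.EqvGen ShareCoord s a}

/-- The graph of an orbit. -/
def orbitGraph {p : Poly2 K} (s : curve p) : SimpleGraph (orbit s) where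
  Adj a b := a ≠ b ∧ ShareCoord a.1 b.1
  symm := ⟨fun _ _ h => ⟨h.1.symm, h.2.imp Eq.symm Eq.symm⟩⟩
  loopless := ⟨fun _ h => h.1 rfl⟩

/-- An infinite path `v 0, v 1, …` in a graph. -/
def IsInfinitePath {V : Type*} (G : SimpleGraph V) (v : ℕ → V) : Prop :=
  ∀ i, G.Adj (v i) (v (i + 1))

/-- No finite section `v i, …, v (i + n)` with `n > 0` is a cycle, i.e. starts and ends at the
same vertex. -/
def CycleFree {V : Type*} (v : ℕ → V) : Prop :=
  ∀ i n, 0 < n → v i ≠ v (i + n)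

/-! ### Poles on the curve -/

/-- A generalized power series is a Puiseux series if its exponents have a common denominator. -/
def IsPuiseux (φ : Series K) : Prop :=
  ∃ n : ℕ, 0 < n ∧ ∀ a ∈ φ.support, ∃ k : ℤ, a = (k : ℚ) / n

/-- The element `x = u⁻¹` of the field of series in `u = x⁻¹`. -/
def xSeries : Series K := HahnSeries.single (-1) 1

/-- `(∞, ∞)` is a pole of `r` on the curve of `p`: there is a Puiseux series `φ` in `x⁻¹` with
`p(x, φ) = 0`, `deg φ > 0` and `deg r(x, φ) > 0`. The degree in `x` is the negative of the order
in `u = x⁻¹`. -/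
def IsPoleAtInfty (p : Poly2 K) (r : Rat2 K) : Prop :=
  ((∞, ∞) : OnePoint K × OnePoint K) ∈ curve p ∧
    ∃ φ : Series K, IsPuiseux φ ∧ MvPolynomial.aeval ![xSeries, φ] p = 0 ∧
      φ.orderTop < 0 ∧ (subst r xSeries φ).orderTop < 0

/-- The fractional linear expression `(a z + b) / (c z + d)` for `g = !![a, b; c, d]`. -/
def moebius {L : Type*} [Field L] [Algebra K L] (g : GL (Fin 2) K) (z : L) : L :=
  (algebraMap K L (g 0 0) * z + algebraMap K L (g 0 1)) /
    (algebraMap K L (g 1 0) * z + algebraMap K L (g 1 1))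

/-- The composition `r ∘ T⁻¹` with the inverse of the transformation
`T = (T₁, T₂)` of `ℙ¹(K) × ℙ¹(K)`. -/
def compInv (r : Rat2 K) (T₁ T₂ : GL (Fin 2) K) : Rat2 K :=
  subst r (moebius T₁⁻¹ X) (moebius T₂⁻¹ Y)

open Classical in
/-- The point `s` is a pole of `r` on the curve associated with `p`: some transformation
`T = (T₁, T₂)` of `ℙ¹(K) × ℙ¹(K)` maps `s` to `(∞, ∞)`, and the latter is a pole of `r ∘ T⁻¹` on
the curve associated with the numerator of `p ∘ T⁻¹`. -/
def IsPole (p : Poly2 K) (r : Rat2 K) (s : OnePoint K × OnePoint K) : Prop :=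
  ∃ T₁ T₂ : GL (Fin 2) K, T₁ • s.1 = ∞ ∧ T₂ • s.2 = ∞ ∧
    IsPoleAtInfty (num (compInv (algebraMap (Poly2 K) (Rat2 K) p) T₁ T₂)) (compInv r T₁ T₂)

end

end SepVar

end

/-!
Near a point `(c₁, c₂)` of the curve, take local parameters `u` at `c₁` and `w` at `c₂`. By the
Newton-Puiseux theorem (remove the subleading coefficient by a Tschirnhaus shift, then straighten an
edge of the Newton polygon; the multiplicity of the root drops), there is a Puiseux series
`ψ(u)` of positive order such that `p` vanishes at `(u, w) = (u, ψ)`. Neither coordinate of this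
parametrization is constant, so evaluating `r + q p = f - g` along it gives `r = f - g`. If
`(c₁, c₂)` is not a pole of `r`, then `f - g` has nonnegative order in `u`, and hence `f` has a pole
at `c₁` if and only if `g` has a pole at `c₂`. Along the path from `v 1` on, consecutive points
share a coordinate, so one pole there would force every point into the finite set of pairs of a pole
of `f` and a pole of `g`, although the points are pairwise distinct.
-/

noncomputable section

namespace SepVar

open Polynomial
open scoped PowerSeries

theorem eval_sub_mul_eval_mem_pow {R : Type*} [CommRing R] {I : Ideal R} {f : R[X]} {a b w : R}
    (hw : f.derivative.eval a * w - 1 ∈ I) (hb : b - a ∈ I) {n : ℕ}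
    (hfb : f.eval b ∈ I ^ (n + 1)) : f.eval (b - w * f.eval b) ∈ I ^ (n + 2) := by
  obtain ⟨k, hk⟩ := f.binomExpansion b (-(w * f.eval b))
  obtain ⟨d, hd⟩ := f.derivative.evalSubFactor b a
  have hfactor : f.eval (b - w * f.eval b) =
      (k * w ^ 2 * f.eval b - d * w * (b - a) - (f.derivative.eval a * w - 1)) * f.eval b := by
    rw [sub_eq_add_neg, hk]
    linear_combination (-w * f.eval b) * hd
  rw [hfactor, pow_succ' I (n + 1)]
  have hfb' : f.eval b ∈ I := Ideal.pow_le_self n.succ_ne_zero hfb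
  exact Ideal.mul_mem_mul
    (I.sub_mem (I.sub_mem (I.mul_mem_left _ hfb') (I.mul_mem_left _ hb)) hw) hfb

theorem exists_forall_sub_mem_pow {R : Type*} [CommRing R] (I : Ideal R) [IsPrecomplete I R]
    {c : ℕ → R} (hc : ∀ n, c (n + 1) - c n ∈ I ^ n) : ∃ b, ∀ n, c n - b ∈ I ^ n := by
  have hcauchy : ∀ m n, m ≤ n → c m ≡ c n [SMOD (I ^ m • ⊤ : Ideal R)] := by
    intro m n hmn
    induction n, hmn using Nat.le_induction with
    | base => rfl
    | succ n hmn ih =>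
      refine ih.trans (SModEq.symm ?_)
      simpa [SModEq.sub_mem] using Ideal.pow_le_pow_right hmn (hc n)
  obtain ⟨b, hb⟩ := IsPrecomplete.prec' c (hcauchy _ _)
  exact ⟨b, fun n => by simpa [SModEq.sub_mem] using hb n⟩

/- Hensel's lemma. Unlike in `HenselianRing`, the polynomial need not be monic: the lemma is applied
to a Hasse derivative, for the Tschirnhaus transformation. -/
theorem exists_isRoot_of_isAdicComplete {R : Type*} [CommRing R] (I : Ideal R)
    [IsAdicComplete I R] {f : R[X]} {a w : R} (ha : f.eval a ∈ I)
    (hw : f.derivative.eval a * w - 1 ∈ I) : ∃ b, f.IsRoot b ∧ b - a ∈ I := by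
  let c : ℕ → R := fun n => (fun b => b - w * f.eval b)^[n] a
  have hc (n : ℕ) : c (n + 1) = c n - w * f.eval (c n) := Function.iterate_succ_apply' ..
  have happrox (n : ℕ) : c n - a ∈ I ∧ f.eval (c n) ∈ I ^ (n + 1) := by
    induction n with
    | zero => simpa [c] using ha
    | succ n ih =>
      refine ⟨?_, hc n ▸ eval_sub_mul_eval_mem_pow hw ih.1 ih.2⟩
      rw [hc, sub_right_comm]
      exact I.sub_mem ih.1 (I.mul_mem_left _ (Ideal.pow_le_self n.succ_ne_zero ih.2))
  obtain ⟨b, hb⟩ := exists_forall_sub_mem_pow I (c := c) fun n => by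
    rw [hc, sub_sub_cancel_left, ← mul_neg]
    exact Ideal.mul_mem_left _ _ (neg_mem (Ideal.pow_le_pow_right n.le_succ (happrox n).2))
  refine ⟨b, IsHausdorff.haus' (I := I) _ fun n => ?_, ?_⟩
  · have hfb : f.eval (c n) - f.eval b ∈ I ^ n :=
      Ideal.mem_of_dvd _ (f.sub_dvd_eval_sub (c n) b) (hb n)
    simpa [SModEq.zero] using sub_mem (Ideal.pow_le_pow_right n.le_succ (happrox n).2) hfb
  · simpa using I.sub_mem (happrox 1).1 (by simpa using hb 1 : c 1 - b ∈ I)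

section NewtonPuiseux

variable {K : Type*} [Field K]

theorem exists_taylor_coeff_eq_zero [CharZero K] {f : K⟦X⟧[X]} {m : ℕ}
    (hm : PowerSeries.constantCoeff (f.coeff m) = 0)
    (hm' : PowerSeries.constantCoeff (f.coeff (m + 1)) ≠ 0) :
    ∃ w, PowerSeries.constantCoeff w = 0 ∧ (taylor w f).coeff m = 0 := by
  have hmem (a : K⟦X⟧) : a ∈ Ideal.span {PowerSeries.X} ↔ PowerSeries.constantCoeff a = 0 := by
    rw [Ideal.mem_span_singleton, PowerSeries.X_dvd_iff]
  have hderiv : PowerSeries.constantCoeff ((hasseDeriv m f).derivative.eval 0) ≠ 0 := by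
    rw [← coeff_zero_eq_eval_zero, coeff_derivative, hasseDeriv_coeff]
    simpa [add_comm 1 m, hm'] using Nat.cast_add_one_ne_zero m
  obtain ⟨w, hroot, hw⟩ := exists_isRoot_of_isAdicComplete (Ideal.span {PowerSeries.X})
    (f := hasseDeriv m f) (a := 0)
    (w := PowerSeries.C (PowerSeries.constantCoeff ((hasseDeriv m f).derivative.eval 0))⁻¹)
    (by simpa [hmem, ← coeff_zero_eq_eval_zero, hasseDeriv_coeff] using hm)
    (by simp [hmem, hderiv])
  exact ⟨w, by simpa [hmem] using hw, by rw [taylor_coeff, hroot]⟩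

theorem exists_rootMultiplicity_lt_natDegree [IsAlgClosed K] [CharZero K] {h : K[X]}
    (hnext : h.nextCoeff = 0) {i : ℕ} (hi : i < h.natDegree) (hcoeff : h.coeff i ≠ 0) :
    ∃ c, h.IsRoot c ∧ h.rootMultiplicity c < h.natDegree := by
  have hn : h.natDegree ≠ 0 := Nat.ne_zero_of_lt hi
  obtain ⟨c, hc⟩ := IsAlgClosed.exists_root h fun hd => hn (natDegree_eq_of_degree_eq_some hd)
  refine ⟨c, hc, lt_of_not_ge fun hle => hcoeff ?_⟩
  have hpow : h = C h.leadingCoeff * (Polynomial.X - C c) ^ h.natDegree :=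
    eq_leadingCoeff_mul_of_monic_of_dvd_of_natDegree_le ((monic_X_sub_C c).pow _)
      ((pow_dvd_pow _ hle).trans (pow_rootMultiplicity_dvd h c)) (by simp)
  have hlead : h.leadingCoeff ≠ 0 := leadingCoeff_ne_zero.2 fun h0 => by simp [h0] at hn
  have hc0 : c = 0 := by
    rw [hpow, nextCoeff_C_mul, (monic_X_sub_C c).nextCoeff_pow, nextCoeff_X_sub_C] at hnext
    simpa [hlead, hn] using hnext
  rw [hpow, hc0]
  simp [coeff_X_pow, hi.ne]

/-- The substitution `t ↦ t ^ N` in power series, as a ring homomorphism. -/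
abbrev expandHom (N : ℕ) (hN : N ≠ 0) : K⟦X⟧ →+* K⟦X⟧ :=
  (PowerSeries.expand N hN : K⟦X⟧ →ₐ[K] K⟦X⟧)

/-- A polynomial over `K⟦t⟧` acquires a root without constant term after adjoining an `N`-th root
of `t`. The field `K((t ^ (1 / N)))` is encoded as `K((t))`, into which the coefficients are mapped
by `t ↦ t ^ N`. -/
def HasRamifiedRoot (f : K⟦X⟧[X]) : Prop :=
  ∃ (N : ℕ) (hN : N ≠ 0) (w : K⟦X⟧), PowerSeries.constantCoeff w = 0 ∧
    (f.map (expandHom N hN)).IsRoot w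

namespace HasRamifiedRoot

theorem of_coeff_zero_eq_zero {f : K⟦X⟧[X]} (h : f.coeff 0 = 0) : HasRamifiedRoot f :=
  ⟨1, one_ne_zero, 0, map_zero _, by simp [IsRoot, ← coeff_zero_eq_eval_zero, h]⟩

theorem of_taylor {f : K⟦X⟧[X]} {w : K⟦X⟧} (hw : PowerSeries.constantCoeff w = 0)
    (h : HasRamifiedRoot (taylor w f)) : HasRamifiedRoot f := by
  obtain ⟨N, hN, z, hz, hroot⟩ := h
  refine ⟨N, hN, z + expandHom N hN w, by simp [hz, hw], ?_⟩
  rwa [map_taylor, IsRoot, taylor_eval] at hroot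

theorem of_map_comp {f h : K⟦X⟧[X]} {N s : ℕ} (hN : N ≠ 0) (hs : s ≠ 0) {a : K⟦X⟧}
    (hfh : (f.map (expandHom N hN)).comp (C (PowerSeries.X ^ s) * Polynomial.X) = C a * h) {c : K}
    (hroot : HasRamifiedRoot (taylor (PowerSeries.C c) h)) : HasRamifiedRoot f := by
  obtain ⟨M, hM, z, -, hz⟩ := hroot
  have hroot' : (h.map (expandHom M hM)).eval (z + PowerSeries.C c) = 0 := by
    rwa [map_taylor, IsRoot, taylor_eval, RingHom.coe_coe, PowerSeries.expand_C] at hz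
  have hcomp : expandHom (K := K) (M * N) (mul_ne_zero hM hN) =
      (expandHom M hM).comp (expandHom N hN) := by
    rw [expandHom, PowerSeries.expand_mul_eq_comp M hM N hN]
    rfl
  refine ⟨M * N, mul_ne_zero hM hN, PowerSeries.X ^ (M * s) * (z + PowerSeries.C c),
    by simp [hM, hs], ?_⟩
  have heval := congrArg (fun q => (q.map (expandHom M hM)).eval (z + PowerSeries.C c)) hfh
  simpa [IsRoot, hcomp, ← Polynomial.map_map, Polynomial.map_comp, hroot', PowerSeries.expand_X,
    ← pow_mul] using heval

end HasRamifiedRoot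

theorem exists_newton_edge {d : ℕ → ℕ∞} {n : ℕ} (hn : 0 < n) (h0 : d 0 ≠ ⊤)
    (hpos : ∀ j < n, d j ≠ 0) :
    ∃ N s : ℕ, N ≠ 0 ∧ s ≠ 0 ∧ (∀ j, (s * n : ℕ∞) ≤ N * d j + s * j) ∧
      ∃ i < n, (N * d i + s * i : ℕ∞) = s * n := by
  classical
  obtain ⟨i, hi, hmin⟩ := Finset.exists_min_image {j ∈ Finset.range n | d j ≠ ⊤}
    (fun j => ((d j).toNat : ℚ) / (n - j)) ⟨0, by simp [hn, h0]⟩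
  simp only [Finset.mem_filter, Finset.mem_range, and_imp] at hi hmin
  obtain ⟨hin, hi⟩ := hi
  obtain ⟨s, hs⟩ := ENat.ne_top_iff_exists.1 hi
  have hN : n - i ≠ 0 := (Nat.sub_pos_of_lt hin).ne'
  refine ⟨n - i, s, hN, fun hs0 => hpos i hin (by simp [← hs, hs0]), fun j => ?_, i, hin, ?_⟩
  · rcases le_or_gt n j with hnj | hjn
    · exact le_add_left (mul_le_mul_right (by exact_mod_cast hnj) _)
    by_cases hj : d j = ⊤
    · rw [hj, ENat.mul_top (by exact_mod_cast hN), top_add]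
      exact le_top
    obtain ⟨e, he⟩ := ENat.ne_top_iff_exists.1 hj
    have hle := hmin j hjn hj
    have hposi : (0 : ℚ) < n - i := sub_pos.2 (by exact_mod_cast hin)
    have hposj : (0 : ℚ) < n - j := sub_pos.2 (by exact_mod_cast hjn)
    rw [← hs, ← he, ENat.toNat_natCast, ENat.toNat_natCast, div_le_div_iff₀ hposi hposj] at hle
    rw [← he]
    have : s * n ≤ (n - i) * e + s * j := by
      zify [hin.le]
      have : (s * (n - j) : ℤ) ≤ e * (n - i) := by exact_mod_cast hle
      linarith
    exact_mod_cast this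
  · rw [← hs]
    norm_cast
    zify [hin.le]
    ring

theorem exists_newton_transform {f : K⟦X⟧[X]} {N s n : ℕ} (hN : N ≠ 0)
    (hline : ∀ j, (s * n : ℕ∞) ≤ N * (f.coeff j).order + s * j) :
    ∃ h : K⟦X⟧[X], (f.map (expandHom N hN)).comp (C (PowerSeries.X ^ s) * Polynomial.X) =
        C (PowerSeries.X ^ (s * n)) * h ∧
      ∀ j, (s * n + (h.coeff j).order : ℕ∞) = N * (f.coeff j).order + s * j := by
  have horder (j : ℕ) : (((f.map (expandHom N hN)).comp
      (C (PowerSeries.X ^ s) * Polynomial.X)).coeff j).order =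
        N * (f.coeff j).order + s * j := by
    rw [comp_C_mul_X_coeff, coeff_map, ← pow_mul, PowerSeries.order_mul, PowerSeries.order_X_pow]
    simp [PowerSeries.order_expand]
  obtain ⟨h, hh⟩ : C (PowerSeries.X ^ (s * n)) ∣
      (f.map (expandHom N hN)).comp (C (PowerSeries.X ^ s) * Polynomial.X) := by
    refine C_dvd_iff_dvd_coeff _ _ |>.2 fun j => PowerSeries.X_pow_dvd_iff.2 fun m hm => ?_
    refine PowerSeries.coeff_of_lt_order _ (lt_of_lt_of_le ?_ ((hline j).trans (horder j).ge))
    exact_mod_cast hm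
  refine ⟨h, hh, fun j => ?_⟩
  rw [← horder, hh, coeff_C_mul, PowerSeries.order_mul, PowerSeries.order_X_pow]
  simp

theorem constantCoeff_ne_zero_of_add_order_eq {φ : K⟦X⟧} {k : ℕ} (h : k + φ.order = k) :
    PowerSeries.constantCoeff φ ≠ 0 := by
  have h0 : φ.order = 0 := by
    simpa using (ENat.addLECancellable_natCast k).inj.1 (h.trans (add_zero _).symm)
  simpa [h0] using PowerSeries.order_ne_zero_iff_constCoeff_eq_zero (φ := φ)

section NewtonTransform

variable {f h : K⟦X⟧[X]} {N s n : ℕ}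

theorem natDegree_map_constantCoeff_of_order (hs : s ≠ 0)
    (hn : PowerSeries.constantCoeff (f.coeff n) ≠ 0)
    (hord : ∀ j, (s * n + (h.coeff j).order : ℕ∞) = N * (f.coeff j).order + s * j) :
    (h.map PowerSeries.constantCoeff).natDegree = n := by
  refine natDegree_eq_of_le_of_coeff_ne_zero (natDegree_le_iff_coeff_eq_zero.2 fun j hj => ?_) ?_
  · rw [coeff_map, ← PowerSeries.order_ne_zero_iff_constCoeff_eq_zero]
    intro h0
    have hle : (s * j : ℕ∞) ≤ s * n := le_add_self.trans (by simpa [h0] using (hord j).ge)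
    have hle' : s * j ≤ s * n := by exact_mod_cast hle
    exact hj.not_ge (le_of_mul_le_mul_left hle' hs.pos)
  · rw [coeff_map]
    have hn0 : (f.coeff n).order = 0 :=
      not_not.1 (PowerSeries.order_ne_zero_iff_constCoeff_eq_zero.not.2 hn)
    exact constantCoeff_ne_zero_of_add_order_eq (k := s * n) (by simpa [hn0] using hord n)

theorem coeff_eq_zero_of_order (hN : N ≠ 0) {j : ℕ} (hj : f.coeff j = 0)
    (hord : (s * n + (h.coeff j).order : ℕ∞) = N * (f.coeff j).order + s * j) :
    h.coeff j = 0 := by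
  rw [hj, PowerSeries.order_zero, ENat.mul_top (by exact_mod_cast hN), top_add] at hord
  by_contra hne
  obtain ⟨k, hk⟩ := ENat.ne_top_iff_exists.1 (mt PowerSeries.order_eq_top.1 hne)
  rw [← hk] at hord
  exact ENat.natCast_ne_top (s * n + k) (by exact_mod_cast hord)

end NewtonTransform

/- The Newton polygon of `f` has an edge of slope `-s / N` that ends at `(n + 1, 0)`; the
substitution `t ↦ t ^ N`, `y ↦ t ^ s y` makes it horizontal. -/
theorem exists_newton_step [IsAlgClosed K] [CharZero K] {f : K⟦X⟧[X]} {n : ℕ}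
    (hlow : ∀ j < n + 1, PowerSeries.constantCoeff (f.coeff j) = 0)
    (htop : PowerSeries.constantCoeff (f.coeff (n + 1)) ≠ 0)
    (hfn : f.coeff n = 0) (hf0 : f.coeff 0 ≠ 0) :
    ∃ (N s : ℕ) (hN : N ≠ 0) (h : K⟦X⟧[X]) (c : K), s ≠ 0 ∧
      (f.map (expandHom N hN)).comp (C (PowerSeries.X ^ s) * Polynomial.X) =
        C (PowerSeries.X ^ (s * (n + 1))) * h ∧
      h.map PowerSeries.constantCoeff ≠ 0 ∧ (h.map PowerSeries.constantCoeff).IsRoot c ∧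
      (h.map PowerSeries.constantCoeff).rootMultiplicity c < n + 1 := by
  obtain ⟨N, s, hN, hs, hline, i, hi, hedge⟩ :=
    exists_newton_edge (d := fun j => (f.coeff j).order) n.succ_pos
      (mt PowerSeries.order_eq_top.1 hf0)
      fun j hj => PowerSeries.order_ne_zero_iff_constCoeff_eq_zero.2 (hlow j hj)
  obtain ⟨h, hh, hord⟩ := exists_newton_transform hN hline
  have hdeg := natDegree_map_constantCoeff_of_order hs htop hord
  have hnext : (h.map PowerSeries.constantCoeff).nextCoeff = 0 := by
    rw [nextCoeff_of_natDegree_pos (by omega), hdeg, Nat.add_sub_cancel, coeff_map,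
      coeff_eq_zero_of_order hN hfn (hord n), map_zero]
  have hcoeff : (h.map PowerSeries.constantCoeff).coeff i ≠ 0 := by
    rw [coeff_map]
    exact constantCoeff_ne_zero_of_add_order_eq (k := s * (n + 1)) (by simpa [hedge] using hord i)
  obtain ⟨c, hc, hmul⟩ := exists_rootMultiplicity_lt_natDegree hnext (hdeg ▸ hi) hcoeff
  exact ⟨N, s, hN, h, c, hs, hh, fun h0 => hcoeff (by rw [h0, coeff_zero]), hc, hdeg ▸ hmul⟩

/- The Newton-Puiseux theorem, by induction on the multiplicity of the root `0` of the reduction. -/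
theorem hasRamifiedRoot [IsAlgClosed K] [CharZero K] {f : K⟦X⟧[X]}
    (hne : f.map PowerSeries.constantCoeff ≠ 0)
    (h0 : (f.map PowerSeries.constantCoeff).IsRoot 0) : HasRamifiedRoot f := by
  induction hn : (f.map PowerSeries.constantCoeff).rootMultiplicity 0
    using Nat.strong_induction_on generalizing f with
  | _ n ih =>
  obtain ⟨n, rfl⟩ := Nat.exists_eq_add_one_of_ne_zero
    (hn ▸ ((rootMultiplicity_pos hne).2 h0).ne')
  rw [rootMultiplicity_eq_natTrailingDegree'] at hn
  have hlow (j : ℕ) (hj : j < n + 1) : PowerSeries.constantCoeff (f.coeff j) = 0 := by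
    rw [← coeff_map, coeff_eq_zero_of_lt_natTrailingDegree (hn ▸ hj)]
  have htop : PowerSeries.constantCoeff (f.coeff (n + 1)) ≠ 0 := by
    rw [← coeff_map, ← hn]
    exact trailingCoeff_nonzero_iff_nonzero.2 hne
  obtain ⟨w, hw, hwn⟩ := exists_taylor_coeff_eq_zero (hlow n n.lt_succ_self) htop
  refine .of_taylor hw ?_
  by_cases hw0 : (taylor w f).coeff 0 = 0
  · exact .of_coeff_zero_eq_zero hw0
  have hred (j : ℕ) : PowerSeries.constantCoeff ((taylor w f).coeff j) =
      PowerSeries.constantCoeff (f.coeff j) := by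
    rw [← coeff_map, map_taylor, hw, taylor_zero, coeff_map]
  obtain ⟨N, s, hN, h, c, hs, hh, hhne, hc, hmul⟩ :=
    exists_newton_step (fun j hj => (hred j).trans (hlow j hj)) ((hred _).trans_ne htop) hwn hw0
  have hmap : (taylor (PowerSeries.C c) h).map PowerSeries.constantCoeff =
      taylor c (h.map PowerSeries.constantCoeff) := by simp
  refine .of_map_comp (c := c) hN hs hh (ih _ hmul ?_ ?_ ?_)
  · rwa [hmap, ne_eq, taylor_eq_zero]
  · simpa [hmap, IsRoot, taylor_eval] using hc
  · rw [hmap, rootMultiplicity_eq_rootMultiplicity (t := c), taylor_apply]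

end NewtonPuiseux

section RamifiedSeries

theorem orderTop_embDomain_pos {R Γ Γ' : Type*} [Zero R] [LinearOrder Γ] [Zero Γ] [LinearOrder Γ']
    [Zero Γ'] {f : Γ ↪o Γ'} (hf : f 0 = 0) {a : HahnSeries Γ R} (ha : 0 < a.orderTop) :
    0 < (HahnSeries.embDomain f a).orderTop := by
  rw [HahnSeries.orderTop_embDomain]
  induction h : a.orderTop with
  | top => exact WithTop.coe_lt_top 0
  | coe g =>
    rw [h, ← WithTop.coe_zero, WithTop.coe_lt_coe, ← f.lt_iff_lt, hf] at ha
    exact WithTop.coe_lt_coe.2 ha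

variable {K : Type*} [Field K]

/-- Laurent series in `t`, read as series in `u = t ^ N`. -/
def ramified (N : ℕ) (hN : N ≠ 0) : HahnSeries ℤ K →+* Series K :=
  have hN : (0 : ℚ) < N := by positivity
  HahnSeries.embDomainRingHom
    { toFun := fun k : ℤ => (k : ℚ) / N
      map_zero' := by simp
      map_add' := fun a b => by push_cast; ring }
    (fun a b h => by simpa [div_left_inj' hN.ne'] using h)
    (fun a b => by simp [div_le_div_iff_of_pos_right hN])

theorem algebraMap_series (a : K) : algebraMap K (Series K) a = HahnSeries.C a := by
  rw [HahnSeries.algebraMap_apply', PowerSeries.algebraMap_apply]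
  exact HahnSeries.ofPowerSeries_C a

theorem isPuiseux_ramified (N : ℕ) (hN : N ≠ 0) (a : HahnSeries ℤ K) :
    IsPuiseux (ramified N hN a) := by
  refine ⟨N, Nat.pos_of_ne_zero hN, fun q hq => ?_⟩
  obtain ⟨k, -, hk⟩ := HahnSeries.support_embDomain_subset hq
  exact ⟨k, hk.symm⟩

theorem ramified_single (N : ℕ) (hN : N ≠ 0) (k : ℤ) (c : K) :
    ramified N hN (HahnSeries.single k c) = HahnSeries.single ((k : ℚ) / N) c :=
  HahnSeries.embDomain_single

theorem orderTop_ramified_pos (N : ℕ) (hN : N ≠ 0) {a : HahnSeries ℤ K} (ha : 0 < a.orderTop) :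
    0 < (ramified N hN a).orderTop :=
  orderTop_embDomain_pos (by simp) ha

theorem orderTop_ofPowerSeries_pos {w : K⟦X⟧} (hw : PowerSeries.constantCoeff w = 0) :
    0 < (HahnSeries.ofPowerSeries ℤ K w).orderTop := by
  refine orderTop_embDomain_pos (by simp) (pos_iff_ne_zero.2 ?_)
  refine HahnSeries.orderTop_ne_of_coeff_eq_zero (i := 0) ?_
  change (HahnSeries.toPowerSeries.symm w).coeff 0 = 0
  rwa [HahnSeries.coeff_toPowerSeries_symm, PowerSeries.coeff_zero_eq_constantCoeff_apply]

/-- The local parameter `u = x⁻¹` at infinity. -/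
def uSeries : Series K := HahnSeries.single 1 1

theorem ramified_comp_expandHom (N : ℕ) (hN : N ≠ 0) :
    (((ramified N hN).comp (HahnSeries.ofPowerSeries ℤ K)).comp (expandHom N hN)).comp
      coeToPowerSeries.ringHom = (aeval (uSeries : Series K) : K[X] →ₐ[K] Series K) := by
  refine Polynomial.ringHom_ext (fun a => ?_) ?_
  · simp [PowerSeries.expand_C, HahnSeries.C_apply, ramified_single, algebraMap_series]
  · simp [PowerSeries.expand_X, ramified_single, hN, uSeries]

theorem exists_isPuiseux_inv_root [IsAlgClosed K] [CharZero K] {h : K[X][X]}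
    (hne : h.map (evalRingHom 0) ≠ 0) (h0 : (h.map (evalRingHom 0)).IsRoot 0) :
    ∃ ψ : Series K, IsPuiseux ψ⁻¹ ∧ 0 < ψ.orderTop ∧
      h.eval₂ (aeval (uSeries : Series K) : K[X] →ₐ[K] Series K) ψ = 0 := by
  have hred : (h.map (coeToPowerSeries.ringHom : K[X] →+* K⟦X⟧)).map PowerSeries.constantCoeff =
      h.map (evalRingHom 0) := by
    rw [Polynomial.map_map]
    congr 1
    ext <;> simp
  obtain ⟨N, hN, w, hw, hroot⟩ := hasRamifiedRoot (hred ▸ hne) (hred ▸ h0)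
  refine ⟨ramified N hN (HahnSeries.ofPowerSeries ℤ K w), ?_,
    orderTop_ramified_pos N hN (orderTop_ofPowerSeries_pos hw), ?_⟩
  · rw [← map_inv₀]
    exact isPuiseux_ramified _ _ _
  · have heval := congrArg ((ramified N hN).comp (HahnSeries.ofPowerSeries ℤ K)) hroot
    rwa [map_zero, Polynomial.map_map, eval_map, hom_eval₂, ← RingHom.comp_assoc,
      ramified_comp_expandHom] at heval

end RamifiedSeries

section Valuation

variable {K L Γ : Type*} [Field K] [Field L] [Algebra K L] [LinearOrderedCommGroupWithZero Γ]
  {v : Valuation L Γ} [v.IsTrivialOn K]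

theorem valuation_le_one_of_sub_lt_one {a : L} {c : K} (h : v (a - algebraMap K L c) < 1) :
    v a ≤ 1 := by
  rw [← sub_add_cancel a (algebraMap K L c)]
  exact v.map_add_le h.le (Valuation.IsTrivialOn.valuation_algebraMap_le_one v c)

theorem valuation_lt_one_iff_of_sub_lt_one {a : L} {c : K} (h : v (a - algebraMap K L c) < 1) :
    v a < 1 ↔ c = 0 := by
  refine ⟨fun ha => ?_, fun hc => by simpa [hc] using h⟩
  by_contra hc
  have hlt : v (algebraMap K L c) < 1 := by simpa using v.map_sub_lt ha h
  exact hlt.ne (Valuation.IsTrivialOn.eq_one c hc)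

theorem valuation_mvPolynomial_aeval_sub_lt_one {σ : Type*} {a : σ → L} {c : σ → K}
    (h : ∀ i, v (a i - algebraMap K L (c i)) < 1) (Q : MvPolynomial σ K) :
    v (MvPolynomial.aeval a Q - algebraMap K L (MvPolynomial.eval c Q)) < 1 := by
  induction Q using MvPolynomial.induction_on with
  | C b => simp
  | add P Q hP hQ =>
    rw [map_add, map_add, map_add, add_sub_add_comm]
    exact v.map_add_lt hP hQ
  | mul_X P i hP =>
    have hsplit : MvPolynomial.aeval a (P * MvPolynomial.X i) -
        algebraMap K L (MvPolynomial.eval c (P * MvPolynomial.X i)) =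
        (MvPolynomial.aeval a P - algebraMap K L (MvPolynomial.eval c P)) * a i +
          algebraMap K L (MvPolynomial.eval c P) * (a i - algebraMap K L (c i)) := by
      simp only [map_mul, MvPolynomial.aeval_X, MvPolynomial.eval_X]
      ring
    rw [hsplit]
    refine v.map_add_lt ?_ ?_
    · rw [map_mul]
      exact mul_lt_one_of_nonneg_of_lt_one_left zero_le hP (valuation_le_one_of_sub_lt_one (h i))
    · rw [map_mul]
      exact mul_lt_one_of_nonneg_of_lt_one_right
        (Valuation.IsTrivialOn.valuation_algebraMap_le_one v _) zero_le (h i)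

theorem valuation_aeval_sub_lt_one {a : L} {c : K} (h : v (a - algebraMap K L c) < 1) (q : K[X]) :
    v (aeval a q - algebraMap K L (q.eval c)) < 1 := by
  have hmv := valuation_mvPolynomial_aeval_sub_lt_one (a := fun _ : Unit => a) (c := fun _ => c)
    (fun _ => h) (aeval (MvPolynomial.X ()) q)
  rw [← aeval_algHom_apply, ← MvPolynomial.coe_aeval_eq_eval, RingHom.coe_coe,
    ← aeval_algHom_apply] at hmv
  simpa using hmv

/-- The point with local parameter `w` near the point `c` of the projective line. -/
def localPoint : OnePoint K → L → L
  | ∞, w => w⁻¹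
  | (s : K), w => algebraMap K L s + w

@[simp]
theorem localPoint_infty (w : L) : localPoint (∞ : OnePoint K) w = w⁻¹ :=
  rfl

@[simp]
theorem localPoint_coe (s : K) (w : L) : localPoint (s : OnePoint K) w = algebraMap K L s + w :=
  rfl

theorem transcendental_localPoint {w : L} (hw : Transcendental K w) (c : OnePoint K) :
    Transcendental K (localPoint c w) := by
  induction c using OnePoint.rec with
  | infty => exact mt IsAlgebraic.inv_iff.1 hw
  | coe s =>
    intro halg
    exact hw (by simpa using halg.sub (isAlgebraic_algebraMap s))

theorem aeval_localPoint_ne_zero {w : L} (hw : Transcendental K w) (c : OnePoint K) {q : K[X]}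
    (hq : q ≠ 0) : aeval (localPoint c w) q ≠ 0 :=
  fun h => hq (transcendental_iff.1 (transcendental_localPoint hw c) q h)

theorem transcendental_of_valuation_lt_one {w : L} (hw0 : w ≠ 0) (hw : v w < 1) :
    Transcendental K w :=
  Valuation.transcendental_of_ne_one (v := v) K w hw0 hw.ne

theorem isPoleOf_iff_one_lt_valuation {w : L} (hw0 : w ≠ 0) (hw : v w < 1) (f : RatFunc K)
    (c : OnePoint K) : IsPoleOf f c ↔
      1 < v (aeval (localPoint c w) f.num / aeval (localPoint c w) f.denom) := by
  have hden : v (aeval (localPoint c w) f.denom) ≠ 0 := v.ne_zero_iff.2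
    (aeval_localPoint_ne_zero (transcendental_of_valuation_lt_one hw0 hw) c f.denom_ne_zero)
  rw [map_div₀, one_lt_div₀ (zero_lt_iff.2 hden)]
  induction c using OnePoint.rec with
  | infty =>
    change f.denom.natDegree < f.num.natDegree ↔ _
    have hpos : 1 < v (localPoint (∞ : OnePoint K) w) := by
      rw [localPoint_infty, map_inv₀]
      exact (one_lt_inv₀ (v.pos_iff.2 hw0)).2 hw
    rcases eq_or_ne f.num 0 with hn | hn
    · simp [hn]
    rw [valuation_aeval_eq_valuation_X_pow_natDegree_of_one_lt_valuation_X _ hpos hn,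
      valuation_aeval_eq_valuation_X_pow_natDegree_of_one_lt_valuation_X _ hpos f.denom_ne_zero,
      pow_lt_pow_iff_right₀ hpos]
  | coe s =>
    have hs (q : K[X]) := valuation_aeval_sub_lt_one (v := v) (a := localPoint (s : OnePoint K) w)
      (c := s) (by simpa using hw) q
    have hle (q : K[X]) := valuation_le_one_of_sub_lt_one (hs q)
    have hlt (q : K[X]) := valuation_lt_one_iff_of_sub_lt_one (hs q)
    change f.denom.eval s = 0 ↔ _
    refine ⟨fun hd => ?_, fun h => (hlt _).1 (h.trans_le (hle _))⟩
    refine ((hlt _).2 hd).trans_le (le_of_not_gt fun hn => ?_)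
    obtain ⟨a, b, hab⟩ := f.isCoprime_num_denom
    simpa [(hlt _).1 hn, hd] using congrArg (eval s) hab

end Valuation

section SeriesValuation

variable {K : Type*} [Field K]

/-- The valuation of the field of series that corresponds to the order in `u`. It is written
multiplicatively, so the series of positive order are those of valuation less than `1`. -/
def seriesValuation : Valuation (Series K) (Multiplicative (WithTop ℚ)ᵒᵈ) :=
  (HahnSeries.addVal ℚ K).toValuation

theorem seriesValuation_lt_one_iff {a : Series K} : seriesValuation a < 1 ↔ 0 < a.orderTop :=
  Iff.rfl

theorem one_lt_seriesValuation_iff {a : Series K} : 1 < seriesValuation a ↔ a.orderTop < 0 :=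
  Iff.rfl

instance : (seriesValuation (K := K)).IsTrivialOn K where
  eq_one a ha := by
    change (algebraMap K (Series K) a).orderTop = 0
    rw [algebraMap_series, HahnSeries.C_apply, HahnSeries.orderTop_single ha, WithTop.coe_zero]

theorem seriesValuation_uSeries_lt_one : seriesValuation (uSeries : Series K) < 1 := by
  rw [seriesValuation_lt_one_iff, uSeries, HahnSeries.orderTop_single one_ne_zero]
  exact WithTop.coe_pos.2 one_pos

theorem uSeries_ne_zero : (uSeries : Series K) ≠ 0 :=
  HahnSeries.single_ne_zero one_ne_zero

theorem xSeries_eq_inv_uSeries : (xSeries : Series K) = uSeries⁻¹ :=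
  eq_inv_of_mul_eq_one_left (by simp [uSeries, xSeries])

end SeriesValuation

section Evaluation

variable {K : Type*} [Field K]

theorem prodMk_mvPolynomial_aeval_mem {σ A B : Type*} [CommRing A] [Algebra K A] [CommRing B]
    [Algebra K B] {S : Subalgebra K (A × B)} {a : σ → A} {b : σ → B} (h : ∀ i, (a i, b i) ∈ S)
    (q : MvPolynomial σ K) : (MvPolynomial.aeval a q, MvPolynomial.aeval b q) ∈ S := by
  let c : σ → S := fun i => ⟨(a i, b i), h i⟩
  have hc : S.val (MvPolynomial.aeval c q) = (MvPolynomial.aeval a q, MvPolynomial.aeval b q) :=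
    Prod.ext
      (DFunLike.congr_fun (MvPolynomial.comp_aeval c (φ := (AlgHom.fst K A B).comp S.val)) q)
      (DFunLike.congr_fun (MvPolynomial.comp_aeval c (φ := (AlgHom.snd K A B).comp S.val)) q)
  exact hc ▸ (MvPolynomial.aeval c q).2

theorem prodMk_aeval_mem {A B : Type*} [CommRing A] [Algebra K A] [CommRing B] [Algebra K B]
    {S : Subalgebra K (A × B)} {a : A} {b : B} (h : (a, b) ∈ S) (q : K[X]) :
    (aeval a q, aeval b q) ∈ S := by
  have hq : aeval (a, b) q = (aeval a q, aeval b q) :=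
    Prod.ext (aeval_algHom_apply (AlgHom.fst K A B) (a, b) q).symm
      (aeval_algHom_apply (AlgHom.snd K A B) (a, b) q).symm
  exact hq ▸ Algebra.adjoin_le (Set.singleton_subset_iff.2 h) (aeval_mem_adjoin_singleton K _)

variable {R L : Type*} [CommRing R] [Algebra K R] [Field L] [Algebra K L]

/-- The graph of the partial extension of `φ : R → L` to the field of fractions of `R`: a fraction
`P / Q` has the value `φ P / φ Q` if `φ Q ≠ 0`. -/
def evaluationGraph (φ : R →ₐ[K] L) : Subalgebra K (FractionRing R × L) where
  carrier := {x | ∃ P Q, φ Q ≠ 0 ∧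
    x.1 * algebraMap R (FractionRing R) Q = algebraMap R (FractionRing R) P ∧ x.2 * φ Q = φ P}
  add_mem' := by
    rintro x y ⟨P, Q, hQ, hx₁, hx₂⟩ ⟨P', Q', hQ', hy₁, hy₂⟩
    refine ⟨P * Q' + P' * Q, Q * Q', by simp [hQ, hQ'], ?_, ?_⟩
    · simp only [Prod.fst_add, map_mul, map_add, ← hx₁, ← hy₁]
      ring
    · simp only [Prod.snd_add, map_mul, map_add, ← hx₂, ← hy₂]
      ring
  mul_mem' := by
    rintro x y ⟨P, Q, hQ, hx₁, hx₂⟩ ⟨P', Q', hQ', hy₁, hy₂⟩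
    refine ⟨P * P', Q * Q', by simp [hQ, hQ'], ?_, ?_⟩
    · simp only [Prod.fst_mul, map_mul, ← hx₁, ← hy₁]
      ring
    · simp only [Prod.snd_mul, map_mul, ← hx₂, ← hy₂]
      ring
  algebraMap_mem' c := ⟨algebraMap K R c, 1, by simp, by
    simp [← IsScalarTower.algebraMap_apply K R (FractionRing R)], by simp⟩

variable {φ : R →ₐ[K] L}

theorem algebraMap_mem_evaluationGraph (P : R) :
    (algebraMap R (FractionRing R) P, φ P) ∈ evaluationGraph φ :=
  ⟨P, 1, by simp, by simp, by simp⟩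

theorem eq_of_mem_evaluationGraph {ρ : FractionRing R} {t t' : L}
    (h : (ρ, t) ∈ evaluationGraph φ) (h' : (ρ, t') ∈ evaluationGraph φ) : t = t' := by
  obtain ⟨P, Q, hQ, h₁, h₂⟩ := h
  obtain ⟨P', Q', hQ', h₁', h₂'⟩ := h'
  dsimp only at h₁ h₂ h₁' h₂'
  have hcross : P * Q' = P' * Q := by
    apply IsFractionRing.injective R (FractionRing R)
    rw [map_mul, map_mul, ← h₁, ← h₁']
    ring
  refine mul_right_cancel₀ (mul_ne_zero hQ hQ') ?_
  have := congrArg φ hcross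
  rw [map_mul, map_mul, ← h₂, ← h₂'] at this
  linear_combination this

variable [IsDomain R]

theorem inv_mem_evaluationGraph {x : FractionRing R × L} (hx : x ∈ evaluationGraph φ)
    (hx0 : x.2 ≠ 0) : x⁻¹ ∈ evaluationGraph φ := by
  obtain ⟨P, Q, hQ, h₁, h₂⟩ := hx
  have hP : φ P ≠ 0 := h₂ ▸ mul_ne_zero hx0 hQ
  have hx1 : x.1 ≠ 0 := by
    intro h
    rw [h, zero_mul, eq_comm, map_eq_zero_iff _ (IsFractionRing.injective _ _)] at h₁
    exact hP (by rw [h₁, map_zero])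
  exact ⟨Q, P, hP, by rw [← h₁, Prod.fst_inv, inv_mul_cancel_left₀ hx1],
    by rw [← h₂, Prod.snd_inv, inv_mul_cancel_left₀ hx0]⟩

theorem div_mem_evaluationGraph {x y : FractionRing R × L} (hx : x ∈ evaluationGraph φ)
    (hy : y ∈ evaluationGraph φ) (hy0 : y.2 ≠ 0) : x / y ∈ evaluationGraph φ := by
  rw [div_eq_mul_inv]
  exact mul_mem hx (inv_mem_evaluationGraph hy hy0)

variable [UniqueFactorizationMonoid R]

theorem mul_algebraMap_den (ρ : FractionRing R) :
    ρ * algebraMap R (FractionRing R) (IsFractionRing.den R ρ) =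
      algebraMap R (FractionRing R) (IsFractionRing.num R ρ) := by
  rw [← eq_div_iff (IsFractionRing.to_map_ne_zero_of_mem_nonZeroDivisors (SetLike.coe_mem _)),
    IsFractionRing.mk'_num_den']

theorem prodMk_num_div_den_mem_evaluationGraph {ρ : FractionRing R}
    (h : φ (IsFractionRing.den R ρ) ≠ 0) :
    (ρ, φ (IsFractionRing.num R ρ) / φ (IsFractionRing.den R ρ)) ∈ evaluationGraph φ :=
  ⟨_, _, h, mul_algebraMap_den ρ, div_mul_cancel₀ _ h⟩

theorem map_den_ne_zero_of_mem_evaluationGraph {ρ : FractionRing R} {t : L}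
    (h : (ρ, t) ∈ evaluationGraph φ) : φ (IsFractionRing.den R ρ) ≠ 0 := by
  obtain ⟨P, Q, hQ, h₁, -⟩ := h
  have hcross : IsFractionRing.num R ρ * Q = P * IsFractionRing.den R ρ := by
    apply IsFractionRing.injective R (FractionRing R)
    rw [map_mul, map_mul, ← h₁, ← mul_algebraMap_den ρ]
    ring
  obtain ⟨c, hc⟩ : (IsFractionRing.den R ρ : R) ∣ Q :=
    (IsFractionRing.num_den_reduced R ρ).symm.dvd_of_dvd_mul_left ⟨P, by rw [hcross, mul_comm]⟩
  intro h0
  exact hQ (by rw [hc, map_mul, h0, zero_mul])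

end Evaluation

section Substitution

variable {K L : Type*} [Field K] [Field L] [Algebra K L]

theorem moebius_mem_evaluationGraph {R : Type*} [CommRing R] [IsDomain R] [Algebra K R]
    {φ : R →ₐ[K] L} {A : FractionRing R} {t : L} (h : (A, t) ∈ evaluationGraph φ)
    (g : GL (Fin 2) K) (ht : algebraMap K L (g 1 0) * t + algebraMap K L (g 1 1) ≠ 0) :
    (moebius g A, moebius g t) ∈ evaluationGraph φ :=
  have hlin (c d : K) := add_mem (mul_mem (algebraMap_mem (evaluationGraph φ) c) h)
    (algebraMap_mem (evaluationGraph φ) d)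
  div_mem_evaluationGraph (hlin (g 0 0) (g 0 1)) (hlin (g 1 0) (g 1 1)) ht

variable {a b : L}

/-- The pairs of a rational function and its value at `(a, b)`. -/
abbrev valueGraph (K : Type*) [Field K] {L : Type*} [Field L] [Algebra K L] (a b : L) :
    Subalgebra K (Rat2 K × L) :=
  evaluationGraph (MvPolynomial.aeval ![a, b] : Poly2 K →ₐ[K] L)

theorem prodMk_X_mem_valueGraph : (X, a) ∈ valueGraph K a b := by
  simpa [SepVar.X] using algebraMap_mem_evaluationGraph (φ := MvPolynomial.aeval ![a, b])
    (MvPolynomial.X 0 : Poly2 K)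

theorem prodMk_Y_mem_valueGraph : (Y, b) ∈ valueGraph K a b := by
  simpa [SepVar.Y] using algebraMap_mem_evaluationGraph (φ := MvPolynomial.aeval ![a, b])
    (MvPolynomial.X 1 : Poly2 K)

theorem ratFunc_eval_mem_valueGraph {A : Rat2 K} {t : L} (h : (A, t) ∈ valueGraph K a b)
    {f : RatFunc K} (hf : aeval t f.denom ≠ 0) :
    (f.eval (algebraMap K (Rat2 K)) A, aeval t f.num / aeval t f.denom) ∈ valueGraph K a b :=
  div_mem_evaluationGraph (prodMk_aeval_mem h f.num) (prodMk_aeval_mem h f.denom) hf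

theorem subst_mem_valueGraph {ρ : Rat2 K} {A B : Rat2 K} {s t : L} (hA : (A, s) ∈ valueGraph K a b)
    (hB : (B, t) ∈ valueGraph K a b) (hρ : MvPolynomial.aeval ![s, t] (den ρ) ≠ 0) :
    (subst ρ A B, subst ρ s t) ∈ valueGraph K a b :=
  have hAB : ∀ i, ((![A, B] : Fin 2 → Rat2 K) i, (![s, t] : Fin 2 → L) i) ∈ valueGraph K a b :=
    Fin.forall_fin_two.2 ⟨hA, hB⟩
  div_mem_evaluationGraph (prodMk_mvPolynomial_aeval_mem hAB _)
    (prodMk_mvPolynomial_aeval_mem hAB _) hρ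

theorem prodMk_subst_mem_valueGraph {ρ : Rat2 K} (h : MvPolynomial.aeval ![a, b] (den ρ) ≠ 0) :
    (ρ, subst ρ a b) ∈ valueGraph K a b :=
  prodMk_num_div_den_mem_evaluationGraph h

theorem subst_eq_of_mem_valueGraph {ρ : Rat2 K} {t : L} (h : (ρ, t) ∈ valueGraph K a b) :
    subst ρ a b = t :=
  eq_of_mem_evaluationGraph
    (prodMk_subst_mem_valueGraph (map_den_ne_zero_of_mem_evaluationGraph h)) h

theorem aeval_num_eq_zero_of_mem_valueGraph {ρ : Rat2 K} (h : (ρ, 0) ∈ valueGraph K a b) :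
    MvPolynomial.aeval ![a, b] (num ρ) = 0 :=
  (div_eq_zero_iff.1 (subst_eq_of_mem_valueGraph h)).resolve_right
    (map_den_ne_zero_of_mem_evaluationGraph h)

theorem compInv_mem_valueGraph {ρ : Rat2 K} {T₁ T₂ : GL (Fin 2) K} {t : L}
    (h₁ : algebraMap K L (T₁⁻¹ 1 0) * a + algebraMap K L (T₁⁻¹ 1 1) ≠ 0)
    (h₂ : algebraMap K L (T₂⁻¹ 1 0) * b + algebraMap K L (T₂⁻¹ 1 1) ≠ 0)
    (h : (ρ, t) ∈ valueGraph K (moebius T₁⁻¹ a) (moebius T₂⁻¹ b)) :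
    (compInv ρ T₁ T₂, t) ∈ valueGraph K a b := by
  rw [← subst_eq_of_mem_valueGraph h]
  exact subst_mem_valueGraph (moebius_mem_evaluationGraph prodMk_X_mem_valueGraph _ h₁)
    (moebius_mem_evaluationGraph prodMk_Y_mem_valueGraph _ h₂)
    (map_den_ne_zero_of_mem_evaluationGraph h)

end Substitution

section GenericPoint

theorem eval₂_ne_zero_of_not_dvd {R L : Type*} [CommRing R] [IsDomain R] [IsGCDMonoid R] [Field L]
    {f : R →+* L} (hf : Function.Injective f) {a : L} {P Q : R[X]} (hP : Irreducible P)
    (hdeg : P.natDegree ≠ 0) (hPa : P.eval₂ f a = 0) (hPQ : ¬ P ∣ Q) : Q.eval₂ f a ≠ 0 := by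
  intro hQa
  let φ : FractionRing R →+* L := IsFractionRing.lift hf
  have hφ (S : R[X]) : (S.map (algebraMap R (FractionRing R))).eval₂ φ a = S.eval₂ f a := by
    rw [eval₂_map]
    congr 1
    ext z
    exact IsFractionRing.lift_algebraMap hf z
  have hprim := hP.isPrimitive hdeg
  have hirr := (hprim.irreducible_iff_irreducible_map_fraction_map (K := FractionRing R)).1 hP
  obtain ⟨s, t, hst⟩ := hirr.coprime_iff_not_dvd.2
    (mt (hprim.dvd_iff_fraction_map_dvd_fraction_map (FractionRing R)).2 hPQ)
  have := congrArg (eval₂ φ a) hst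
  simp [eval₂_add, eval₂_mul, hφ, hPa, hQa] at this

theorem aeval_ne_zero_of_not_dvd {σ K L : Type*} [CommRing K] [IsDomain K]
    [UniqueFactorizationMonoid K] [Field L] [Algebra K L] {p d : MvPolynomial σ K}
    (hp : Irreducible p) {i : σ} (hdeg : p.degreeOf i ≠ 0) {a : σ → L}
    (ha : AlgebraicIndependent K fun k : {k // k ≠ i} => a k)
    (hpa : MvPolynomial.aeval a p = 0) (hd : ¬ p ∣ d) : MvPolynomial.aeval a d ≠ 0 := by
  classical
  let e : MvPolynomial σ K ≃ₐ[K] (MvPolynomial {k // k ≠ i} K)[X] :=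
    (MvPolynomial.renameEquiv K (Equiv.optionSubtypeNe i).symm).trans
      (MvPolynomial.optionEquivLeft K {k // k ≠ i})
  let ψ : (MvPolynomial {k // k ≠ i} K)[X] →ₐ[K] L :=
    eval₂AlgHom (MvPolynomial.aeval fun k : {k // k ≠ i} => a k) (a i) fun _ => Commute.all _ _
  have hψ : ψ.comp e = MvPolynomial.aeval a := by
    ext k
    rcases eq_or_ne k i with rfl | hk
    · simp [ψ, e]
    · simp [ψ, e, hk]
  rw [← hψ] at hpa ⊢
  refine eval₂_ne_zero_of_not_dvd ha ((MulEquiv.irreducible_iff e).2 hp) ?_ hpa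
    ((map_dvd_iff e).not.2 hd)
  rwa [MvPolynomial.degreeOf_eq_natDegree] at hdeg

end GenericPoint

section LocalEquation

variable {K : Type*} [Field K]

/-- Homogeneous coordinates of the point with local parameter `w` near the point `c` of the
projective line. -/
def localCoords {A : Type*} [CommRing A] [Algebra K A] : OnePoint K → A → Fin 2 → A
  | ∞, w => ![w, 1]
  | (s : K), w => ![1, algebraMap K A s + w]

theorem localCoords_zero_right (c : OnePoint K) : localCoords c (0 : K) = coords c := by
  induction c using OnePoint.rec <;> simp [localCoords, coords]

theorem map_localCoords {A B : Type*} [CommRing A] [Algebra K A] [CommRing B] [Algebra K B]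
    (θ : A →ₐ[K] B) (c : OnePoint K) (w : A) (i : Fin 2) :
    θ (localCoords c w i) = localCoords c (θ w) i := by
  induction c using OnePoint.rec <;> fin_cases i <;> simp [localCoords]

section Field

variable {L : Type*} [Field L] [Algebra K L]

theorem localCoords_zero_ne_zero (c : OnePoint K) {w : L} (hw : w ≠ 0) :
    localCoords c w 0 ≠ 0 := by
  induction c using OnePoint.rec <;> simp [localCoords, hw]

theorem localCoords_one_div_localCoords_zero (c : OnePoint K) (w : L) :
    localCoords c w 1 / localCoords c w 0 = localPoint c w := by
  induction c using OnePoint.rec <;> simp [localCoords]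

theorem localCoords_pow_sub_mul_localCoords_pow (c : OnePoint K) {w : L}
    (hw : localCoords c w 0 ≠ 0) {k n : ℕ} (hkn : k ≤ n) :
    localCoords c w 0 ^ (n - k) * localCoords c w 1 ^ k =
      localCoords c w 0 ^ n * localPoint c w ^ k := by
  rw [← localCoords_one_div_localCoords_zero, div_pow, ← Nat.sub_add_cancel hkn, pow_add,
    Nat.add_sub_cancel, mul_assoc, mul_div_cancel₀ _ (pow_ne_zero k hw)]

end Field

section Fintype

variable {σ : Type*} [Fintype σ]

/-- The multi-homogenization of `p` in the local parameters near the point `c`: the local equation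
at `c` of the hypersurface defined by `p` in the product of projective lines. -/
def localEquation (c : σ → OnePoint K) (p : MvPolynomial σ K) : MvPolynomial σ K :=
  ∑ m ∈ p.support, MvPolynomial.C (p.coeff m) *
    ∏ i, (localCoords (c i) (MvPolynomial.X i) 0 ^ (p.degreeOf i - m i) *
      localCoords (c i) (MvPolynomial.X i) 1 ^ m i)

theorem aeval_localEquation {A : Type*} [CommRing A] [Algebra K A] (c : σ → OnePoint K)
    (p : MvPolynomial σ K) (w : σ → A) : MvPolynomial.aeval w (localEquation c p) =
      ∑ m ∈ p.support, algebraMap K A (p.coeff m) *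
        ∏ i, (localCoords (c i) (w i) 0 ^ (p.degreeOf i - m i) *
          localCoords (c i) (w i) 1 ^ m i) := by
  simp only [localEquation, map_sum, map_mul, map_prod, map_pow, map_localCoords,
    MvPolynomial.aeval_X, MvPolynomial.algHom_C]

theorem aeval_localEquation_eq_zero_iff {L : Type*} [Field L] [Algebra K L] {c : σ → OnePoint K}
    {p : MvPolynomial σ K} {w : σ → L} (hw : ∀ i, localCoords (c i) (w i) 0 ≠ 0) :
    MvPolynomial.aeval w (localEquation c p) = 0 ↔
      MvPolynomial.aeval (fun i => localPoint (c i) (w i)) p = 0 := by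
  have hfactor : MvPolynomial.aeval w (localEquation c p) =
      (∏ i, localCoords (c i) (w i) 0 ^ p.degreeOf i) *
        MvPolynomial.aeval (fun i => localPoint (c i) (w i)) p := by
    rw [aeval_localEquation, MvPolynomial.aeval_def, MvPolynomial.eval₂_eq', Finset.mul_sum]
    refine Finset.sum_congr rfl fun m hm => ?_
    rw [mul_left_comm, ← Finset.prod_mul_distrib]
    congr 1
    exact Finset.prod_congr rfl fun i _ => localCoords_pow_sub_mul_localCoords_pow (c i) (hw i)
      (MvPolynomial.monomial_le_degreeOf i hm)
  rw [hfactor, mul_eq_zero,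
    or_iff_right (Finset.prod_ne_zero_iff.2 fun i _ => pow_ne_zero _ (hw i))]

end Fintype

theorem eval_zero_localEquation (c : Fin 2 → OnePoint K) (p : Poly2 K) :
    MvPolynomial.eval 0 (localEquation c p) = biHom p (coords (c 0)) (coords (c 1)) := by
  have h := aeval_localEquation c p (0 : Fin 2 → K)
  simpa [localCoords_zero_right, biHom, mul_assoc, MvPolynomial.coe_aeval_eq_eval] using h

theorem mem_curve_of_aeval_localPoint_eq_zero {L Γ : Type*} [Field L] [Algebra K L]
    [LinearOrderedCommGroupWithZero Γ] {v : Valuation L Γ} [v.IsTrivialOn K] {p : Poly2 K}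
    {c : Fin 2 → OnePoint K} {w : Fin 2 → L} (hw0 : ∀ i, w i ≠ 0) (hw : ∀ i, v (w i) < 1)
    (h : MvPolynomial.aeval (fun i => localPoint (c i) (w i)) p = 0) : (c 0, c 1) ∈ curve p := by
  rw [← aeval_localEquation_eq_zero_iff fun i => localCoords_zero_ne_zero _ (hw0 i)] at h
  have hsub := valuation_mvPolynomial_aeval_sub_lt_one (v := v) (a := w) (c := 0)
    (by simpa using hw) (localEquation c p)
  have hzero := (valuation_lt_one_iff_of_sub_lt_one hsub).1 (by simp [h])
  rwa [eval_zero_localEquation] at hzero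

end LocalEquation

section NoLine

variable {K : Type*} [Field K]

/-- The coefficient of the highest power of the variable `i` in `p`, as a polynomial in the other
variable `j`. -/
def topCoeff (p : Poly2 K) (i j : Fin 2) : K[X] :=
  ∑ m ∈ p.support with m i = p.degreeOf i, monomial (m j) (p.coeff m)

theorem topCoeff_ne_zero {p : Poly2 K} (hp : p ≠ 0) {i j : Fin 2} (hij : i ≠ j) :
    topCoeff p i j ≠ 0 := by
  obtain ⟨m, hm, hmi⟩ : ∃ m ∈ p.support, p.degreeOf i = m i := by
    rw [MvPolynomial.degreeOf_eq_sup]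
    exact Finset.exists_mem_eq_sup _ (by simpa using hp) _
  have hcoeff : (topCoeff p i j).coeff (m j) = p.coeff m := by
    rw [topCoeff, finsetSum_coeff, Finset.sum_eq_single_of_mem m (by simp_all), coeff_monomial,
      if_pos rfl]
    intro m' hm' hne
    rw [coeff_monomial, if_neg]
    refine fun hmj => hne (Finsupp.ext fun k => ?_)
    obtain rfl | rfl : k = i ∨ k = j := by omega
    · rw [(Finset.mem_filter.1 hm').2, hmi]
    · exact hmj
  intro h0
  rw [h0, coeff_zero] at hcoeff
  exact MvPolynomial.mem_support_iff.1 hm hcoeff.symm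

variable {L : Type*} [Field L] [Algebra K L] {p : Poly2 K} {i j : Fin 2}
  {c : Fin 2 → OnePoint K} {w : Fin 2 → L}

theorem aeval_localEquation_of_infty (hij : i ≠ j) (hc : c i = ∞) (hi : w i = 0) (hj : w j ≠ 0) :
    MvPolynomial.aeval w (localEquation c p) = localCoords (c j) (w j) 0 ^ p.degreeOf j *
      aeval (localPoint (c j) (w j)) (topCoeff p i j) := by
  have huniv : (Finset.univ : Finset (Fin 2)) = {i, j} := by
    ext k
    simp only [Finset.mem_univ, Finset.mem_insert, Finset.mem_singleton, true_iff]
    omega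
  rw [aeval_localEquation, topCoeff, map_sum, Finset.mul_sum, Finset.sum_filter]
  refine Finset.sum_congr rfl fun m hm => ?_
  have hle : m i ≤ p.degreeOf i := MvPolynomial.monomial_le_degreeOf i hm
  rw [huniv, Finset.prod_pair hij, localCoords_pow_sub_mul_localCoords_pow (c j)
    (localCoords_zero_ne_zero _ hj) (MvPolynomial.monomial_le_degreeOf j hm), hc, hi]
  split_ifs with hmi
  · simp only [localCoords, hmi, aeval_monomial, Nat.sub_self, Matrix.cons_val_zero,
      Matrix.cons_val_one, pow_zero, one_pow]
    ring
  · simp [localCoords, Nat.sub_ne_zero_of_lt (lt_of_le_of_ne hle hmi)]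

theorem not_dvd_X_sub_C (hj : p.degreeOf j ≠ 0) (hij : i ≠ j) (s : K) :
    ¬ p ∣ MvPolynomial.X i - MvPolynomial.C s := by
  have hne : (MvPolynomial.X i - MvPolynomial.C s : Poly2 K) ≠ 0 := by
    intro h0
    simpa using congrArg (MvPolynomial.eval fun _ => s + 1) h0
  have hdeg : (MvPolynomial.X i - MvPolynomial.C s : Poly2 K).degreeOf j = 0 := by
    refine Nat.le_zero.1 ((MvPolynomial.degreeOf_sub_le _ _ _).trans ?_)
    rw [MvPolynomial.degreeOf_C, MvPolynomial.degreeOf_X, if_neg hij.symm, max_self]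
  rintro ⟨q, hq⟩
  rw [hq] at hne hdeg
  rw [MvPolynomial.degreeOf_mul_eq (left_ne_zero_of_mul hne) (right_ne_zero_of_mul hne)] at hdeg
  exact hj (Nat.eq_zero_of_add_eq_zero_right hdeg)

theorem aeval_ne_zero_of_transcendental (hp : Irreducible p) (hij : i ≠ j)
    (hdeg : p.degreeOf i ≠ 0) {a : Fin 2 → L} (ha : Transcendental K (a j))
    (hpa : MvPolynomial.aeval a p = 0) {d : Poly2 K} (hd : ¬ p ∣ d) :
    MvPolynomial.aeval a d ≠ 0 := by
  let _ : Unique {k : Fin 2 // k ≠ i} :=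
    { default := ⟨j, hij.symm⟩
      uniq := fun k => Subtype.ext (by have := k.2; change k.1 = j; omega) }
  exact aeval_ne_zero_of_not_dvd hp hdeg (algebraicIndependent_unique_type_iff.2 ha) hpa hd

theorem aeval_localEquation_ne_zero (hp : Irreducible p) (hdeg : ∀ k, p.degreeOf k ≠ 0)
    (hij : i ≠ j) (hi : w i = 0) (hj : Transcendental K (w j)) :
    MvPolynomial.aeval w (localEquation c p) ≠ 0 := by
  have hj0 : w j ≠ 0 := by
    intro h0
    exact hj (h0 ▸ isAlgebraic_zero)
  have hj1 := localCoords_zero_ne_zero (c j) hj0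
  cases hci : c i using OnePoint.rec with
  | infty =>
    rw [aeval_localEquation_of_infty hij hci hi hj0]
    exact mul_ne_zero (pow_ne_zero _ hj1)
      (aeval_localPoint_ne_zero hj (c j) (topCoeff_ne_zero hp.ne_zero hij))
  | coe s =>
    have hcoords (k : Fin 2) : localCoords (c k) (w k) 0 ≠ 0 := by
      obtain rfl | rfl : k = i ∨ k = j := by omega
      · simp [hci, localCoords]
      · exact hj1
    rw [Ne, aeval_localEquation_eq_zero_iff hcoords]
    intro hzero
    refine aeval_ne_zero_of_transcendental hp hij (hdeg i) (transcendental_localPoint hj _) hzero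
      (not_dvd_X_sub_C (hdeg j) hij s) ?_
    simp [hci, hi]

end NoLine

section Chart

variable {K L : Type*} [Field K] [Field L] [Algebra K L]

/-- A transformation of the projective line that maps `∞` to `c`. -/
def chart : OnePoint K → GL (Fin 2) K
  | ∞ => 1
  | (s : K) => Matrix.GeneralLinearGroup.mkOfDetNeZero !![s, 1; 1, 0] (by simp)

open Classical in
theorem chart_inv_smul (c : OnePoint K) : (chart c)⁻¹ • c = ∞ := by
  rw [inv_smul_eq_iff]
  induction c using OnePoint.rec with
  | infty => exact (one_smul _ _).symm
  | coe s => simp [OnePoint.smul_infty_eq_ite, chart, Matrix.GeneralLinearGroup.mkOfDetNeZero]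

theorem chart_denom_ne_zero (c : OnePoint K) {w : L} (hw : w ≠ 0) :
    algebraMap K L (chart c 1 0) * w⁻¹ + algebraMap K L (chart c 1 1) ≠ 0 := by
  induction c using OnePoint.rec with
  | infty => simp [chart]
  | coe s => simpa [chart, Matrix.GeneralLinearGroup.mkOfDetNeZero] using hw

theorem moebius_chart (c : OnePoint K) {w : L} (hw : w ≠ 0) :
    moebius (chart c) w⁻¹ = localPoint c w := by
  induction c using OnePoint.rec with
  | infty => simp [chart, moebius]
  | coe s =>
    simp only [chart, moebius, localPoint_coe, Matrix.GeneralLinearGroup.val_mkOfDetNeZero,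
      Matrix.of_apply, Matrix.cons_val_zero, Matrix.cons_val_one, map_one, map_zero]
    field_simp
    ring

theorem compInv_chart_inv_mem_valueGraph {ρ : Rat2 K} {c₁ c₂ : OnePoint K} {w₁ w₂ t : L}
    (h₁ : w₁ ≠ 0) (h₂ : w₂ ≠ 0)
    (h : (ρ, t) ∈ valueGraph K (localPoint c₁ w₁) (localPoint c₂ w₂)) :
    (compInv ρ (chart c₁)⁻¹ (chart c₂)⁻¹, t) ∈ valueGraph K w₁⁻¹ w₂⁻¹ := by
  apply compInv_mem_valueGraph <;> rw [inv_inv]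
  · exact chart_denom_ne_zero c₁ h₁
  · exact chart_denom_ne_zero c₂ h₂
  · rwa [inv_inv, moebius_chart c₁ h₁, moebius_chart c₂ h₂]

end Chart

section Parametrization

variable {K : Type*} [Field K]

theorem localPoint_vecCons {L : Type*} [Field L] [Algebra K L] (c₁ c₂ : OnePoint K) (w₁ w₂ : L) :
    (fun i : Fin 2 => localPoint (![c₁, c₂] i) (![w₁, w₂] i)) =
      ![localPoint c₁ w₁, localPoint c₂ w₂] := by
  ext i
  fin_cases i <;> rfl

theorem transcendental_uSeries : Transcendental K (uSeries : Series K) :=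
  transcendental_of_valuation_lt_one uSeries_ne_zero seriesValuation_uSeries_lt_one

theorem eval₂_aeval_C_X {A : Type*} [CommRing A] [Algebra K A] (a b : A) (P : Poly2 K) :
    (MvPolynomial.aeval ![C Polynomial.X, Polynomial.X] P : K[X][X]).eval₂
      (aeval a : K[X] →ₐ[K] A) b = MvPolynomial.aeval ![a, b] P := by
  let θ : K[X][X] →ₐ[K] A := eval₂AlgHom (aeval a) b fun _ => Commute.all _ _
  have hθ : θ.comp (MvPolynomial.aeval ![C Polynomial.X, Polynomial.X]) =
      MvPolynomial.aeval ![a, b] := by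
    ext i
    fin_cases i <;> simp [θ]
  exact DFunLike.congr_fun hθ P

theorem aeval_aeval_zero_X {A : Type*} [CommRing A] [Algebra K A] (b : A) (P : Poly2 K) :
    aeval b (MvPolynomial.aeval ![0, Polynomial.X] P : K[X]) = MvPolynomial.aeval ![0, b] P := by
  have hcomp : (aeval b).comp (MvPolynomial.aeval ![0, (Polynomial.X : K[X])]) =
      MvPolynomial.aeval ![0, b] := by
    ext i
    fin_cases i <;> simp
  exact DFunLike.congr_fun hcomp P

theorem exists_isPuiseux_inv_of_eval_zero [IsAlgClosed K] [CharZero K] {P : Poly2 K}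
    (hP : (MvPolynomial.aeval ![0, Polynomial.X] P : K[X]) ≠ 0)
    (h0 : MvPolynomial.eval ![0, 0] P = 0) :
    ∃ ψ : Series K, IsPuiseux ψ⁻¹ ∧ 0 < ψ.orderTop ∧ MvPolynomial.aeval ![uSeries, ψ] P = 0 := by
  let h : K[X][X] := MvPolynomial.aeval ![C Polynomial.X, Polynomial.X] P
  have hred : h.map (evalRingHom 0) = MvPolynomial.aeval ![0, Polynomial.X] P := by
    have hcomp : (mapAlgHom (aeval 0 : K[X] →ₐ[K] K)).comp
        (MvPolynomial.aeval ![C Polynomial.X, Polynomial.X]) =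
        MvPolynomial.aeval ![0, (Polynomial.X : K[X])] := by
      ext i
      fin_cases i <;> simp
    exact DFunLike.congr_fun hcomp P
  have hroot : (h.map (evalRingHom 0)).IsRoot 0 := by
    rwa [hred, IsRoot, ← coe_aeval_eq_eval, aeval_aeval_zero_X]
  obtain ⟨ψ, hpui, hpos, hψ⟩ := exists_isPuiseux_inv_root (hred ▸ hP) hroot
  exact ⟨ψ, hpui, hpos, eval₂_aeval_C_X uSeries ψ P ▸ hψ⟩

theorem exists_parametrization [IsAlgClosed K] [CharZero K] {p : Poly2 K} (hp : Irreducible p)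
    (hdeg : ∀ k, p.degreeOf k ≠ 0) {c₁ c₂ : OnePoint K} (hc : (c₁, c₂) ∈ curve p) :
    ∃ ψ : Series K, IsPuiseux ψ⁻¹ ∧ ψ ≠ 0 ∧ seriesValuation ψ < 1 ∧
      MvPolynomial.aeval ![localPoint c₁ uSeries, localPoint c₂ ψ] p = 0 := by
  have hred : (MvPolynomial.aeval ![0, Polynomial.X] (localEquation ![c₁, c₂] p) : K[X]) ≠ 0 := by
    intro h
    have hline := aeval_aeval_zero_X (uSeries : Series K) (localEquation ![c₁, c₂] p)
    rw [h, map_zero] at hline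
    exact aeval_localEquation_ne_zero hp hdeg zero_ne_one rfl transcendental_uSeries hline.symm
  obtain ⟨ψ, hpui, hpos, hroot⟩ := exists_isPuiseux_inv_of_eval_zero hred (by
    rw [show ![(0 : K), 0] = 0 by simp, eval_zero_localEquation]
    exact hc)
  have hψ0 : ψ ≠ 0 := by
    rintro rfl
    exact aeval_localEquation_ne_zero hp hdeg one_ne_zero rfl transcendental_uSeries hroot
  refine ⟨ψ, hpui, hψ0, seriesValuation_lt_one_iff.2 hpos, ?_⟩
  rwa [aeval_localEquation_eq_zero_iff, localPoint_vecCons] at hroot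
  exact Fin.forall_fin_two.2
    ⟨localCoords_zero_ne_zero _ uSeries_ne_zero, localCoords_zero_ne_zero _ hψ0⟩

end Parametrization

section Poles

variable {K : Type*} [Field K] {p : Poly2 K} {r : Rat2 K} {c₁ c₂ : OnePoint K} {ψ : Series K}

theorem isPole_of_one_lt_seriesValuation (hpui : IsPuiseux ψ⁻¹) (hψ0 : ψ ≠ 0)
    (hψ : seriesValuation ψ < 1)
    (hzero : MvPolynomial.aeval ![localPoint c₁ uSeries, localPoint c₂ ψ] p = 0) {t : Series K}
    (hr : (r, t) ∈ valueGraph K (localPoint c₁ uSeries) (localPoint c₂ ψ))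
    (ht : 1 < seriesValuation t) : IsPole p r (c₁, c₂) := by
  have hpT := algebraMap_mem_evaluationGraph
    (φ := MvPolynomial.aeval ![localPoint c₁ uSeries, localPoint c₂ ψ]) p
  rw [hzero] at hpT
  have hnum := aeval_num_eq_zero_of_mem_valueGraph
    (compInv_chart_inv_mem_valueGraph uSeries_ne_zero hψ0 hpT)
  have hrT := subst_eq_of_mem_valueGraph
    (compInv_chart_inv_mem_valueGraph uSeries_ne_zero hψ0 hr)
  refine ⟨(chart c₁)⁻¹, (chart c₂)⁻¹, chart_inv_smul c₁, chart_inv_smul c₂, ?_, ψ⁻¹, hpui, ?_, ?_,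
    ?_⟩
  · refine mem_curve_of_aeval_localPoint_eq_zero (c := ![∞, ∞]) (w := ![uSeries, ψ])
      (v := seriesValuation) (Fin.forall_fin_two.2 ⟨uSeries_ne_zero, hψ0⟩)
      (Fin.forall_fin_two.2 ⟨seriesValuation_uSeries_lt_one, hψ⟩) ?_
    rwa [localPoint_vecCons]
  · rwa [xSeries_eq_inv_uSeries]
  · rw [← one_lt_seriesValuation_iff, map_inv₀]
    exact (one_lt_inv₀ (seriesValuation.pos_iff.2 hψ0)).2 hψ
  · rwa [xSeries_eq_inv_uSeries, hrT, ← one_lt_seriesValuation_iff]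

theorem eq_sub_of_mem_F {L : Type*} [Field L] [Algebra K L] {f g : RatFunc K} {a b t : L}
    (hfg : (f, g) ∈ F r p) (hf : aeval a f.denom ≠ 0) (hg : aeval b g.denom ≠ 0)
    (hp0 : MvPolynomial.aeval ![a, b] p = 0)
    (hp : ∀ d, ¬ p ∣ d → MvPolynomial.aeval ![a, b] d ≠ 0) (hr : (r, t) ∈ valueGraph K a b) :
    t = aeval a f.num / aeval a f.denom - aeval b g.num / aeval b g.denom := by
  obtain ⟨q, hq, heq⟩ := hfg
  have hpv := algebraMap_mem_evaluationGraph (φ := MvPolynomial.aeval ![a, b]) p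
  rw [hp0] at hpv
  have hsum := add_mem hr (mul_mem (prodMk_subst_mem_valueGraph (hp (den q) hq)) hpv)
  have hdiff := sub_mem (ratFunc_eval_mem_valueGraph (b := b) prodMk_X_mem_valueGraph hf)
    (ratFunc_eval_mem_valueGraph prodMk_Y_mem_valueGraph hg)
  rw [Prod.mk_mul_mk, Prod.mk_add_mk, mul_zero, add_zero, ← heq] at hsum
  exact eq_of_mem_evaluationGraph hsum hdiff

theorem valuation_le_one_iff_of_sub_le_one {L Γ : Type*} [Field L]
    [LinearOrderedCommGroupWithZero Γ] {v : Valuation L Γ} {a b : L} (h : v (a - b) ≤ 1) :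
    v a ≤ 1 ↔ v b ≤ 1 := by
  constructor
  · intro ha
    simpa using v.map_sub_le ha h
  · intro hb
    simpa using v.map_add_le h hb

variable [IsAlgClosed K] [CharZero K]

theorem isPoleOf_iff_isPoleOf (hp : Irreducible p) (hdeg : ∀ k, p.degreeOf k ≠ 0)
    (hr : r ∈ localRing p) {f g : RatFunc K} (hfg : (f, g) ∈ F r p) (hc : (c₁, c₂) ∈ curve p)
    (hpole : ¬ IsPole p r (c₁, c₂)) : IsPoleOf f c₁ ↔ IsPoleOf g c₂ := by
  obtain ⟨ψ, hpui, hψ0, hψ, hzero⟩ := exists_parametrization hp hdeg hc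
  have hψtr := transcendental_of_valuation_lt_one (K := K) hψ0 hψ
  have hnotdvd (d : Poly2 K) (hd : ¬ p ∣ d) :
      MvPolynomial.aeval ![localPoint c₁ uSeries, localPoint c₂ ψ] d ≠ 0 :=
    aeval_ne_zero_of_transcendental hp zero_ne_one (hdeg 0) (transcendental_localPoint hψtr c₂)
      hzero hd
  have hrv := prodMk_subst_mem_valueGraph (hnotdvd _ hr)
  have hle := not_lt.1 (mt (isPole_of_one_lt_seriesValuation hpui hψ0 hψ hzero hrv) hpole)
  rw [eq_sub_of_mem_F hfg (aeval_localPoint_ne_zero transcendental_uSeries c₁ f.denom_ne_zero)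
    (aeval_localPoint_ne_zero hψtr c₂ g.denom_ne_zero) hzero hnotdvd hrv] at hle
  rw [isPoleOf_iff_one_lt_valuation (uSeries_ne_zero (K := K)) seriesValuation_uSeries_lt_one f c₁,
    isPoleOf_iff_one_lt_valuation hψ0 hψ g c₂, ← not_le, ← not_le]
  exact (valuation_le_one_iff_of_sub_le_one hle).not

end Poles

section Propagation

theorem finite_setOf_isPoleOf {K : Type*} [Field K] (f : RatFunc K) :
    {c | IsPoleOf f c}.Finite := by
  refine ((f.denom.rootSet_finite K).image OnePoint.some).insert ∞ |>.subset fun c hc => ?_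
  induction c using OnePoint.rec with
  | infty => exact Set.mem_insert _ _
  | coe s =>
    exact Set.mem_insert_of_mem _ ⟨s, mem_rootSet.2 ⟨f.denom_ne_zero, by simpa using! hc⟩, rfl⟩

variable {α β : Type*} {v : ℕ → α × β} {P : Set α} {Q : Set β}

theorem mem_prod_of_fst_zero_mem (hv : ∀ i, (v i).1 = (v (i + 1)).1 ∨ (v i).2 = (v (i + 1)).2)
    (hPQ : ∀ i, (v i).1 ∈ P ↔ (v i).2 ∈ Q) (h0 : (v 0).1 ∈ P) (i : ℕ) : v i ∈ P ×ˢ Q := by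
  induction i with
  | zero => exact ⟨h0, (hPQ 0).1 h0⟩
  | succ i ih =>
    rcases hv i with h | h
    · have hP := h ▸ ih.1
      exact ⟨hP, (hPQ _).1 hP⟩
    · have hQ := h ▸ ih.2
      exact ⟨(hPQ _).2 hQ, hQ⟩

theorem fst_zero_notMem_of_injective (hinj : Function.Injective v)
    (hv : ∀ i, (v i).1 = (v (i + 1)).1 ∨ (v i).2 = (v (i + 1)).2) (hP : P.Finite) (hQ : Q.Finite)
    (hPQ : ∀ i, (v i).1 ∈ P ↔ (v i).2 ∈ Q) : (v 0).1 ∉ P := fun h0 =>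
  Set.infinite_range_of_injective hinj
    ((hP.prod hQ).subset (Set.range_subset_iff.2 (mem_prod_of_fst_zero_mem hv hPQ h0)))

theorem injective_of_cycleFree {V : Type*} {v : ℕ → V} (hv : CycleFree v) :
    Function.Injective v := by
  refine .of_lt_imp_ne fun i j hij => ?_
  simpa only [Nat.add_sub_cancel' hij.le] using hv i (j - i) (Nat.sub_pos_of_lt hij)

end Propagation

theorem not_isPoleOf_of_injective {K : Type*} [Field K] [IsAlgClosed K] [CharZero K] {p : Poly2 K}
    (hp : Irreducible p) (hdeg : ∀ k, p.degreeOf k ≠ 0) {r : Rat2 K} (hr : r ∈ localRing p)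
    {f g : RatFunc K} (hfg : (f, g) ∈ F r p) {v : ℕ → curve p} (hinj : Function.Injective v)
    (hshare : ∀ i, ShareCoord (v i) (v (i + 1))) (hpoles : ∀ i, ¬ IsPole p r (v i).1) :
    ¬ IsPoleOf f (v 0).1.1 ∧ ¬ IsPoleOf g (v 0).1.2 := by
  have hiff (i : ℕ) : IsPoleOf f (v i).1.1 ↔ IsPoleOf g (v i).1.2 :=
    isPoleOf_iff_isPoleOf hp hdeg hr hfg (v i).2 (hpoles i)
  have hf := fst_zero_notMem_of_injective (Subtype.val_injective.comp hinj) hshare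
    (finite_setOf_isPoleOf f) (finite_setOf_isPoleOf g) hiff
  exact ⟨hf, mt (hiff 0).2 hf⟩

end SepVar

end

theorem mainTheorem7_general {K : Type*} [Field K] [IsAlgClosed K] [CharZero K]
    {p : SepVar.Poly2 K} (hp : Irreducible p) (hpx : 0 < p.degreeOf 0) (hpy : 0 < p.degreeOf 1)
    {r : SepVar.Rat2 K} (hr : r ∈ SepVar.localRing p)
    {f g : RatFunc K} (hfg : (f, g) ∈ SepVar.F r p)
    {v : ℕ → SepVar.curve p} (hinj : Function.Injective v)
    (hshare : ∀ i, SepVar.ShareCoord (v i) (v (i + 1)))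
    (hpoles : ∀ i, ¬ SepVar.IsPole p r (v (i + 1)).1) :
    (¬ SepVar.IsPoleOf f (v 0).1.1 ∨ ¬ SepVar.IsPoleOf g (v 0).1.2) ∧
    ((v 1).1.1 = (v 0).1.1 → ¬ SepVar.IsPoleOf f (v 0).1.1) ∧
    ((v 1).1.2 = (v 0).1.2 → ¬ SepVar.IsPoleOf g (v 0).1.2) := by
  have hdeg : ∀ k, p.degreeOf k ≠ 0 := Fin.forall_fin_two.2 ⟨hpx.ne', hpy.ne'⟩
  obtain ⟨hf, hg⟩ := SepVar.not_isPoleOf_of_injective hp hdeg hr hfg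
    (hinj.comp (add_left_injective 1)) (fun i => hshare (i + 1)) hpoles
  have hfst : (v 1).1.1 = (v 0).1.1 → ¬ SepVar.IsPoleOf f (v 0).1.1 := fun h => h ▸ hf
  have hsnd : (v 1).1.2 = (v 0).1.2 → ¬ SepVar.IsPoleOf g (v 0).1.2 := fun h => h ▸ hg
  exact ⟨(hshare 0).imp (hfst ·.symm) (hsnd ·.symm), hfst, hsnd⟩

theorem mainTheorem7 {K : Type*} [Field K] [IsAlgClosed K] [CharZero K]
    (p : SepVar.Poly2 K) (hp : Irreducible p)
    (hpx : 0 < p.degreeOf 0) (hpy : 0 < p.degreeOf 1)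
    (r : SepVar.Rat2 K) (hr : r ∈ SepVar.localRing p)
    (f g : RatFunc K) (hfg : (f, g) ∈ SepVar.F r p)
    (s : SepVar.curve p) (hs : SepVar.IsPole p r s.1)
    (v : ℕ → SepVar.orbit s) (hv : SepVar.IsInfinitePath (SepVar.orbitGraph s) v)
    (hcycle : SepVar.CycleFree v) (hstart : (v 0).1 = s)
    (hpoles : ∀ i, SepVar.IsPole p r (v i).1.1 → (v i).1 = s) :
    (¬ SepVar.IsPoleOf f s.1.1 ∨ ¬ SepVar.IsPoleOf g s.1.2) ∧
    ((v 1).1.1.1 = s.1.1 → ¬ SepVar.IsPoleOf f s.1.1) ∧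
    ((v 1).1.1.2 = s.1.2 → ¬ SepVar.IsPoleOf g s.1.2) := by
  have hinj := SepVar.injective_of_cycleFree hcycle
  simpa only [Function.comp_apply, hstart] using mainTheorem7_general hp hpx hpy hr hfg
    (Subtype.val_injective.comp hinj) (fun i => (hv i).2) fun i hpole =>
      hinj.ne i.succ_ne_zero (Subtype.ext ((hpoles (i + 1) hpole).trans hstart.symm))
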